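/- Let $q\ge 2$ be an integer and let $(\varepsilon_d)_{d\mid q}$ be a probability vector indexed by the positive divisors of $q$. Let $V$ be the generalized erasure channel with input alphabet $\mathcal X=\mathbb Z/q\mathbb Z$, output alphabet the disjoint union $\bigsqcup_{d\mid q}\mathbb Z/d\mathbb Z$, and transition probabilities $V(y\mid x)=\varepsilon_d$ if $y=\varphi_d(x)$ for some $d\mid q$, and $V(y\mid x)=0$ otherwise, where $\varphi_d:\mathbb Z/q\mathbb Z\to\mathbb Z/d\mathbb Z$ is the reduction map. All logarithms have base $q$. For a channel $W:\mathcal U\to\mathcal Y$ with finite input alphabet $\mathcal U$ let $$I(W)=\sum_{y}\sum_{x\in\mathcal U}\frac1{|\mathcal U|}W(y\mid x)\log\frac{W(y\mid x)}{\sum_{x'\in\mathcal U}\frac1{|\mathcal U|}W(y\mid x')}$$ be its symmetric capacity (with $0\log 0=0$). Fix a unit $\gamma$ of $\mathbb Z/q\mathbb Z$. For a channel $W$ with input alphabet $\mathcal X$ put $$W^-(y_1,y_2\mid u_1)=\sum_{u_2\in\mathcal X}\tfrac1q W(y_1\mid u_1+\gamma u_2)\,W(y_2\mid u_2),\qquad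 W^+(y_1,y_2,u_1\mid u_2)=\tfrac1q W(y_1\mid u_1+\gamma u_2)\,W(y_2\mid u_2),$$ and $W^{s}=(\cdots(W^{s_1})^{s_2}\cdots)^{s_n}$ for $s=s_1\cdots s_n\in\{-,+\}^n$. For a subgroup $N$ of $\mathcal X$ let $W[N]:\mathcal X/N\to\mathcal Y$ be the homomorphism channel $W[N](y\mid a+N)=\frac1{|N|}\sum_{x\in a+N}W(y\mid x)$. Define $\varepsilon_d^{s}$ recursively, starting from $\varepsilon_d$ for the empty sequence, by $$\varepsilon_d^{s-}=\sum_{d_1,d_2\mid q,\ \gcd(d_1,d_2)=d}\varepsilon_{d_1}^{s}\varepsilon_{d_2}^{s},\qquad \varepsilon_d^{s+}=\sum_{d_1,d_2\mid q,\ \operatorname{lcm}(d_1,d_2)=d}\varepsilon_{d_1}^{s}\varepsilon_{d_2}^{s},$$ and $\mu_d^{(n)}=2^{-n}\sum_{s\in\{-,+\}^n}\varepsilon_d^{s}$. Then for every $d\mid q$ the limit $\mu_d^{(\infty)}=\lim_{n\to\infty}\mu_d^{(n)}$ exists, and for every unit $\gamma$, every fixed $\delta$ with $0<\delta<\log p$,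 where $p$ is the smallest prime factor of $q$, and every $d\mid q$, $$\lim_{n\to\infty}\frac1{2^n}\Big|\Big\{s\in\{-,+\}^n:\ \big|I(V^{s})-\log d\big|<\delta\ \text{ and }\ \big|I(V^{s}[\ker\varphi_d])-\log d\big|<\delta\Big\}\Big|=\mu_d^{(\infty)}.$$ Moreover, for every subgroup $N$ of $\mathbb Z/q\mathbb Z$, $$\lim_{n\to\infty}\frac1{2^n}\Big|\Big\{s\in\{-,+\}^n:\ \big|I(V^{s})-\log[\mathcal X:N]\big|<\delta\ \text{ and }\ \big|I(V^{s}[N])-\log[\mathcal X:N]\big|<\delta\Big\}\Big|=\mu_{[\mathcal X:N]}^{(\infty)},$$ and $\sum_{d\mid q}\mu_d^{(\infty)}=1$. -/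

import Mathlib

noncomputable section

namespace PolarErasure

/-- A discrete memoryless channel with input alphabet `X` and a finite output alphabet:
`W.prob x y` is the transition probability `W(y | x)`. -/
structure Channel (X : Type) where
  Out : Type
  fintypeOut : Fintype Out
  prob : X → Out → ℝ
  prob_nonneg : ∀ x y, 0 ≤ prob x y
  sum_prob : ∀ x, ∑ y, prob x y = 1

attribute [instance] Channel.fintypeOut

/-- The symmetric capacity of `W`, with logarithms to base `b`
(a summand with `W(y | x) = 0` vanishes, i.e. `0 log 0 = 0`). -/
def symCapacity (b : ℝ) {X : Type} [Fintype X] (W : Channel X) : ℝ :=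
  ∑ y : W.Out, ∑ x : X, 1 / (Fintype.card X : ℝ) * W.prob x y *
    Real.logb b (W.prob x y / ∑ x' : X, 1 / (Fintype.card X : ℝ) * W.prob x' y)

/-- The worse channel
`W⁻(y₁, y₂ | u₁) = ∑_{u₂} (1/|X|) W(y₁ | u₁ ∗ u₂) W(y₂ | u₂)`. -/
def minus {X : Type} [Fintype X] (op : X → X → X) (W : Channel X) : Channel X where
  Out := W.Out × W.Out
  fintypeOut := inferInstance
  prob u₁ y := ∑ u₂ : X, 1 / (Fintype.card X : ℝ) * W.prob (op u₁ u₂) y.1 * W.prob u₂ y.2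
  prob_nonneg u₁ y := Finset.sum_nonneg fun u₂ _ =>
    mul_nonneg (mul_nonneg (by positivity) (W.prob_nonneg _ _)) (W.prob_nonneg _ _)
  sum_prob u₁ := by
    have : Nonempty X := ⟨u₁⟩
    have hX : (Fintype.card X : ℝ) ≠ 0 := Nat.cast_ne_zero.mpr Fintype.card_ne_zero
    rw [Finset.sum_comm]
    have h : ∀ u₂ : X, ∑ y : W.Out × W.Out,
        1 / (Fintype.card X : ℝ) * W.prob (op u₁ u₂) y.1 * W.prob u₂ y.2
          = 1 / (Fintype.card X : ℝ) := by
      intro u₂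
      rw [Fintype.sum_prod_type]
      simp only [← Finset.mul_sum, W.sum_prob, mul_one]
    simp only [h, Finset.sum_const, Finset.card_univ, nsmul_eq_mul]
    field_simp

/-- The better channel
`W⁺(y₁, y₂, u₁ | u₂) = (1/|X|) W(y₁ | u₁ ∗ u₂) W(y₂ | u₂)`. -/
def plus {X : Type} [Fintype X] (op : X → X → X) (W : Channel X) : Channel X where
  Out := (W.Out × W.Out) × X
  fintypeOut := inferInstance
  prob u₂ y := 1 / (Fintype.card X : ℝ) * W.prob (op y.2 u₂) y.1.1 * W.prob u₂ y.1.2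
  prob_nonneg u₂ y :=
    mul_nonneg (mul_nonneg (by positivity) (W.prob_nonneg _ _)) (W.prob_nonneg _ _)
  sum_prob u₂ := by
    have : Nonempty X := ⟨u₂⟩
    have hX : (Fintype.card X : ℝ) ≠ 0 := Nat.cast_ne_zero.mpr Fintype.card_ne_zero
    rw [Fintype.sum_prod_type, Finset.sum_comm]
    have h : ∀ u₁ : X, ∑ y : W.Out × W.Out,
        1 / (Fintype.card X : ℝ) * W.prob (op u₁ u₂) y.1 * W.prob u₂ y.2
          = 1 / (Fintype.card X : ℝ) := by
      intro u₁
      rw [Fintype.sum_prod_type]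
      simp only [← Finset.mul_sum, W.sum_prob, mul_one]
    simp only [h, Finset.sum_const, Finset.card_univ, nsmul_eq_mul]
    field_simp

/-- The synthetic channel `W^s = (⋯(W^{s₁})^{s₂}⋯)^{sₙ}` of a sign sequence of length `n`;
`false` stands for the sign `-` and `true` for the sign `+`. -/
def synthetic {X : Type} [Fintype X] (op : X → X → X) (W : Channel X) :
    (n : ℕ) → (Fin n → Bool) → Channel X
  | 0, _ => W
  | n + 1, s =>
    if s (Fin.last n) then plus op (synthetic op W n (Fin.init s))
    else minus op (synthetic op W n (Fin.init s))

instance quotientFintype {X : Type} [AddCommGroup X] [Fintype X] (N : AddSubgroup X) :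
    Fintype (X ⧸ N) := Fintype.ofFinite _

/-- The homomorphism channel
`W[N](y | a + N) = (1/|N|) ∑_{x ∈ a + N} W(y | x)`, with input alphabet `X / N`. -/
def homChannel {X : Type} [AddCommGroup X] [Fintype X] (W : Channel X) (N : AddSubgroup X) :
    Channel (X ⧸ N) where
  Out := W.Out
  fintypeOut := W.fintypeOut
  prob a y := 1 / (Nat.card N : ℝ) *
    ∑ x ∈ (Set.toFinite {x : X | (QuotientAddGroup.mk x : X ⧸ N) = a}).toFinset, W.prob x y
  prob_nonneg a y := mul_nonneg (by positivity)
    (Finset.sum_nonneg fun x _ => W.prob_nonneg x y)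
  sum_prob a := by
    rw [← Finset.mul_sum, Finset.sum_comm]
    simp only [W.sum_prob, Finset.sum_const, nsmul_eq_mul, mul_one]
    obtain ⟨g, rfl⟩ := QuotientAddGroup.mk_surjective a
    have hc : (Set.toFinite {x : X | (QuotientAddGroup.mk x : X ⧸ N) = QuotientAddGroup.mk g}
        ).toFinset.card = Nat.card N := by
      rw [← Set.ncard_eq_toFinset_card, ← Nat.card_coe_set_eq]
      refine Nat.card_congr
        { toFun := fun x => ⟨-g + x.1, QuotientAddGroup.eq.mp x.2.symm⟩
          invFun := fun m => ⟨g + m.1, ?_⟩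
          left_inv := fun x => by simp
          right_inv := fun m => by simp }
      exact (QuotientAddGroup.eq.mpr (by simp)).symm
    rw [hc]
    have hN : (Nat.card N : ℝ) ≠ 0 := Nat.cast_ne_zero.mpr Nat.card_pos.ne'
    field_simp

/-- `(ε_d)_{d | q}` is a probability vector (the values of `ε` off the divisors of `q` play no
role). -/
structure IsProbVec (q : ℕ) (ε : ℕ → ℝ) : Prop where
  nonneg : ∀ d ∈ q.divisors, 0 ≤ ε d
  sum_eq_one : ∑ d ∈ q.divisors, ε d = 1

/-- The reduction homomorphism `φ_d : ℤ/qℤ → ℤ/dℤ` for `d | q`. -/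
def phi {q d : ℕ} (h : d ∣ q) : ZMod q →+* ZMod d := ZMod.castHom h (ZMod d)

instance neZeroDivisor (q : ℕ) (d : q.divisors) : NeZero (d : ℕ) :=
  ⟨(Nat.pos_of_mem_divisors d.2).ne'⟩

/-- The generalized erasure channel `V` with erasure probability vector `(ε_d)_{d | q}`: its
output alphabet is the disjoint union of the `ℤ/dℤ` over `d | q`, and `V(y | x) = ε_d` if
`y = φ_d(x)` in the summand of index `d`, and `V(y | x) = 0` otherwise. -/
def erasureChannel (q : ℕ) (ε : ℕ → ℝ) (hε : IsProbVec q ε) : Channel (ZMod q) where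
  Out := Σ d : q.divisors, ZMod d
  fintypeOut := inferInstance
  prob x y := if y.2 = phi (Nat.dvd_of_mem_divisors y.1.2) x then ε y.1 else 0
  prob_nonneg x y := by
    split_ifs
    · exact hε.nonneg _ y.1.2
    · exact le_rfl
  sum_prob x := by
    rw [Fintype.sum_sigma]
    refine Eq.trans (Finset.sum_congr rfl fun d _ => ?_)
      ((Finset.sum_coe_sort q.divisors ε).trans hε.sum_eq_one)
    exact (Finset.sum_ite_eq' Finset.univ (phi (Nat.dvd_of_mem_divisors d.2) x)
      fun _ => ε d).trans (if_pos (Finset.mem_univ _))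

/-- The vector `(ε_d^s)_{d | q}` of a sign sequence `s` of length `n` (`false` is `-`, `true` is
`+`): in each step, `ε_d^{s-} = ∑_{gcd(d₁,d₂) = d} ε_{d₁}^s ε_{d₂}^s` and
`ε_d^{s+} = ∑_{lcm(d₁,d₂) = d} ε_{d₁}^s ε_{d₂}^s`. -/
def epsSeq (q : ℕ) (ε : ℕ → ℝ) : (n : ℕ) → (Fin n → Bool) → ℕ → ℝ
  | 0, _, d => ε d
  | n + 1, s, d =>
    ∑ d₁ ∈ q.divisors, ∑ d₂ ∈ q.divisors,
      if (if s (Fin.last n) then Nat.lcm d₁ d₂ else Nat.gcd d₁ d₂) = d then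
        epsSeq q ε n (Fin.init s) d₁ * epsSeq q ε n (Fin.init s) d₂
      else 0

/-- The average `μ_d^{(n)} = 2⁻ⁿ ∑_{s ∈ {-,+}ⁿ} ε_d^s`. -/
def muAvg (q : ℕ) (ε : ℕ → ℝ) (d n : ℕ) : ℝ :=
  1 / 2 ^ n * ∑ s : Fin n → Bool, epsSeq q ε n s d

/-- The fraction of the sign sequences `s` of length `n` for which `I(W^s)` and `I(W^s[N])` are
both within `δ` of the level `L`. The polar transforms use `a ∗ b = a + γ b` on `ℤ/qℤ`, and
all logarithms have base `q`. -/
def levelFraction {q : ℕ} [NeZero q] (γ : (ZMod q)ˣ) (W : Channel (ZMod q))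
    (N : AddSubgroup (ZMod q)) (L δ : ℝ) (n : ℕ) : ℝ :=
  1 / 2 ^ n * (Set.ncard {s : Fin n → Bool |
    |symCapacity q (synthetic (fun a b => a + (γ : ZMod q) * b) W n s) - L| < δ ∧
    |symCapacity q
      (homChannel (synthetic (fun a b => a + (γ : ZMod q) * b) W n s) N) - L| < δ} : ℝ)

end PolarErasure

end

/-! Every synthetic channel `V^s` is again an erasure channel up to relabelling of outputs: each
output reveals exactly one coset of some `dℤ/qℤ`. Two such outputs constrain `u₁ + γ u₂` and `u₂` by
congruences modulo `d₁` and `d₂`. Since `γ` is a unit, they determine `u₁` modulo `gcd(d₁, d₂)` and,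
once `u₁` is known, `u₂` modulo `lcm(d₁, d₂)`. This is the recursion for `ε^s`. Hence
(`isErasureLike_synthetic`) the two capacities are the means under `ε^s` of `log m` and of `log
gcd(m, [X : N])`.

The rest concerns random divisors. Let `F` be the mass of the multiples of `m`. A minus step sends
`F` to `F²`, and a plus step sends it to at least `2F - F²`, so the average of `F` over signs is
nondecreasing and converges. Subtracting the contributions of larger divisors gives convergence of
`μ_d`. The average of `F²` is bounded and grows at each step by at least the average of `(F(1 -
F))²`, which therefore tends to 0. As this holds for all `m`, and divisibility separates divisors,
two independent samples from `ε^s` agree with probability tending to 1 on average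
(`tendsto_spread`).

So for most `s` the vector `ε^s` concentrates on one divisor. The two capacities detect whether it
is `d`: distinct comparable divisors have logarithms at least `log p` apart. Thus the indicator of
the level event differs from `ε_d^s` by at most a constant times the spread
(`abs_indicator_sub_le`), and averaging finishes the proof. -/

open Filter Topology

namespace PolarErasure

/-! ### Symmetric capacity of channels with two-valued likelihoods -/

section Capacity

/-- A channel whose likelihoods given `y` take only the values `0` and `w y * g y`, where `w` is
the output distribution, has symmetric capacity `∑ w y log (g y)`. -/
theorem symCapacity_eq_of_two_valued (b : ℝ) {X : Type} [Fintype X] (W : Channel X)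
    (w g : W.Out → ℝ)
    (hW : ∀ x y, W.prob x y = 0 ∨ W.prob x y = w y * g y)
    (hw : ∀ y, ∑ x : X, 1 / (Fintype.card X : ℝ) * W.prob x y = w y) :
    symCapacity b W = ∑ y, w y * Real.logb b (g y) := by
  unfold symCapacity
  refine Finset.sum_congr rfl fun y _ => ?_
  rw [hw y]
  -- Expanding `w y` back into its sum over inputs lets the two sides be compared input by input.
  conv_rhs => rw [← hw y, Finset.sum_mul]
  refine Finset.sum_congr rfl fun x _ => ?_
  rcases hW x y with h | h
  · simp [h]
  · by_cases hz : w y = 0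
    · simp [h, hz]
    · rw [h, mul_div_cancel_left₀ _ hz]

end Capacity

/-! ### Divisibility, cosets and subgroups in `ℤ/qℤ` -/

section Divisibility

variable {q : ℕ} [NeZero q]

theorem dvd_val_iff_castHom_eq_zero {d : ℕ} (hd : d ∣ q) (x : ZMod q) :
    d ∣ x.val ↔ ZMod.castHom hd (ZMod d) x = 0 := by
  rw [ZMod.castHom_apply, ← ZMod.natCast_val, ZMod.natCast_eq_zero_iff]

theorem natCast_dvd_iff {d : ℕ} (hd : d ∣ q) (x : ZMod q) : (d : ZMod q) ∣ x ↔ d ∣ x.val := by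
  constructor
  · rintro ⟨c, rfl⟩
    rw [dvd_val_iff_castHom_eq_zero hd, map_mul, map_natCast, ZMod.natCast_self, zero_mul]
  · rintro ⟨k, hk⟩
    exact ⟨(k : ZMod q), by rw [← Nat.cast_mul, ← hk, ZMod.natCast_zmod_val]⟩

-- Bézout: the ideals generated by `a` and `b` sum to the ideal generated by the gcd. Neither number
-- has to divide `q`.
omit [NeZero q] in
theorem natCast_gcd_dvd_iff (a b : ℕ) (x : ZMod q) :
    ((Nat.gcd a b : ℕ) : ZMod q) ∣ x ↔ ∃ u : ZMod q, (a : ZMod q) ∣ x + u ∧ (b : ZMod q) ∣ u := by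
  constructor
  · rintro ⟨c, rfl⟩
    have h := congrArg (Int.cast : ℤ → ZMod q) (Nat.gcd_eq_gcd_ab a b)
    push_cast at h
    refine ⟨-((b : ZMod q) * ((Nat.gcdB a b : ℤ) : ZMod q) * c), ?_, ?_⟩
    · rw [h]
      exact ⟨((Nat.gcdA a b : ℤ) : ZMod q) * c, by ring⟩
    · exact ⟨-(((Nat.gcdB a b : ℤ) : ZMod q) * c), by ring⟩
  · rintro ⟨u, h1, h2⟩
    have ha : ((Nat.gcd a b : ℕ) : ZMod q) ∣ a := Nat.cast_dvd_cast (Nat.gcd_dvd_left a b)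
    have hb : ((Nat.gcd a b : ℕ) : ZMod q) ∣ b := Nat.cast_dvd_cast (Nat.gcd_dvd_right a b)
    exact (dvd_add_left (hb.trans h2)).mp (ha.trans h1)

theorem natCast_lcm_dvd_iff {a b : ℕ} (ha : a ∣ q) (hb : b ∣ q) (x : ZMod q) :
    ((Nat.lcm a b : ℕ) : ZMod q) ∣ x ↔ (a : ZMod q) ∣ x ∧ (b : ZMod q) ∣ x := by
  rw [natCast_dvd_iff ha, natCast_dvd_iff hb, natCast_dvd_iff (Nat.lcm_dvd ha hb), Nat.lcm_dvd_iff]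

open Classical in
theorem card_natCast_dvd {d : ℕ} (hd : d ∣ q) :
    (Finset.univ.filter fun x : ZMod q => (d : ZMod q) ∣ x).card * d = q := by
  obtain ⟨k, hk⟩ := id hd
  have hq : 0 < q := Nat.pos_of_neZero q
  have hd0 : 0 < d := Nat.pos_of_dvd_of_pos hd hq
  have : (Finset.univ.filter fun x : ZMod q => (d : ZMod q) ∣ x).card = k := by
    rw [← Finset.card_range k]
    symm
    refine Finset.card_bij (fun i _ => ((d * i : ℕ) : ZMod q)) ?_ ?_ ?_
    · intro i _
      simp
    · intro i hi j hj h
      rw [Finset.mem_range] at hi hj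
      have hi' : d * i < q := hk ▸ (Nat.mul_lt_mul_left hd0).mpr hi
      have hj' : d * j < q := hk ▸ (Nat.mul_lt_mul_left hd0).mpr hj
      have h' := congrArg ZMod.val h
      rw [ZMod.val_natCast_of_lt hi', ZMod.val_natCast_of_lt hj'] at h'
      exact Nat.eq_of_mul_eq_mul_left hd0 h'
    · intro x hx
      obtain ⟨i, hi⟩ := (natCast_dvd_iff hd x).mp (Finset.mem_filter.mp hx).2
      refine ⟨i, ?_, ?_⟩
      · have := ZMod.val_lt x
        rw [Finset.mem_range]
        rw [hi] at this
        exact (Nat.mul_lt_mul_left hd0).mp (hk ▸ this)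
      · rw [← hi, ZMod.natCast_zmod_val]
  rw [this, hk, mul_comm]

open Classical in
theorem sum_ite_natCast_dvd {d : ℕ} (hd : d ∣ q) (f : ZMod q ≃ ZMod q) (c : ℝ) :
    ∑ x : ZMod q, (if (d : ZMod q) ∣ f x then c else 0) = q / d * c := by
  rw [Equiv.sum_comp f fun x => if (d : ZMod q) ∣ x then c else 0, ← Finset.sum_filter,
    Finset.sum_const, nsmul_eq_mul]
  have hd0 : (d : ℝ) ≠ 0 :=
    Nat.cast_ne_zero.mpr (Nat.pos_of_dvd_of_pos hd (Nat.pos_of_neZero q)).ne'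
  congr 1
  rw [eq_div_iff hd0]
  exact_mod_cast card_natCast_dvd hd

open Classical in
/-- The cosets of `aℤ/qℤ` and `bℤ/qℤ` given by two congruences meet in a coset of
`lcm(a, b)ℤ/qℤ` if they meet at all. -/
theorem sum_ite_and_natCast_dvd {a b : ℕ} (ha : a ∣ q) (hb : b ∣ q) (x₀ : ZMod q) (c : ℝ) :
    ∑ x : ZMod q, (if (a : ZMod q) ∣ x - x₀ ∧ (b : ZMod q) ∣ x - x₀ then c else 0)
      = q / (Nat.lcm a b : ℕ) * c := by
  simp only [← natCast_lcm_dvd_iff ha hb]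
  exact sum_ite_natCast_dvd (Nat.lcm_dvd ha hb) (Equiv.subRight x₀) c

/-- The index annihilates the quotient, so its multiples lie in `N`; both sets have `q / N.index`
elements. -/
theorem mem_iff_index_natCast_dvd (N : AddSubgroup (ZMod q)) (x : ZMod q) :
    x ∈ N ↔ (N.index : ZMod q) ∣ x := by
  classical
  have hdvd : N.index ∣ q := by
    simpa using N.index_dvd_card
  have hsub : (Finset.univ.filter fun x : ZMod q => (N.index : ZMod q) ∣ x)
      ⊆ Finset.univ.filter fun x : ZMod q => x ∈ N := by
    intro x hx
    obtain ⟨c, rfl⟩ := (Finset.mem_filter.mp hx).2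
    refine Finset.mem_filter.mpr ⟨Finset.mem_univ _, ?_⟩
    rw [← nsmul_eq_mul]
    exact N.nsmul_index_mem c
  have hcard : (Finset.univ.filter fun x : ZMod q => x ∈ N).card * N.index = q := by
    have h := N.card_mul_index
    rw [Nat.card_zmod, Nat.card_eq_fintype_card, Fintype.card_subtype] at h
    exact h
  have heq := Finset.eq_of_subset_of_card_le hsub (by
    refine le_of_eq (Nat.eq_of_mul_eq_mul_right
      (Nat.pos_of_dvd_of_pos hdvd (Nat.pos_of_neZero q)) ?_)
    rw [hcard, card_natCast_dvd hdvd])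
  have := Finset.ext_iff.mp heq x
  simpa using this.symm

end Divisibility

/-! ### Erasure structure of the synthetic channels and their capacities -/

section ErasureLike

variable {q : ℕ} [NeZero q]

open Classical in
/-- `W` is, up to relabelling of outputs, an erasure channel with parameters `e`: the output `y`
has probability `w y` and reveals exactly the coset `r y + (d y)ℤ/qℤ` of the input. -/
def IsErasureLike (W : Channel (ZMod q)) (e : ℕ → ℝ) : Prop :=
  ∃ (d : W.Out → ℕ) (r : W.Out → ZMod q) (w : W.Out → ℝ),
    (∀ y, d y ∣ q) ∧
    (∀ x y, W.prob x y = if (d y : ZMod q) ∣ x - r y then w y * d y else 0) ∧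
    ∀ f : ℕ → ℝ, ∑ y, w y * f (d y) = ∑ m ∈ q.divisors, e m * f m

/-- The law of `op d₁ d₂` for independent `d₁`, `d₂` with law `e` on the divisors of `q`. -/
def combine (q : ℕ) (op : ℕ → ℕ → ℕ) (e : ℕ → ℝ) (d : ℕ) : ℝ :=
  ∑ d₁ ∈ q.divisors, ∑ d₂ ∈ q.divisors, if op d₁ d₂ = d then e d₁ * e d₂ else 0

theorem sum_combine {q : ℕ} {op : ℕ → ℕ → ℕ}
    (hop : ∀ a ∈ q.divisors, ∀ b ∈ q.divisors, op a b ∈ q.divisors) (e f : ℕ → ℝ) :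
    ∑ d ∈ q.divisors, combine q op e d * f d
      = ∑ a ∈ q.divisors, ∑ b ∈ q.divisors, e a * e b * f (op a b) := by
  simp only [combine, Finset.sum_mul]
  rw [Finset.sum_comm]
  refine Finset.sum_congr rfl fun a ha => ?_
  rw [Finset.sum_comm]
  refine Finset.sum_congr rfl fun b hb => ?_
  simp only [ite_mul, zero_mul]
  rw [Finset.sum_ite_eq, if_pos (hop a ha b hb)]

theorem gcd_mem_divisors {q : ℕ} : ∀ a ∈ q.divisors, ∀ b ∈ q.divisors,
    Nat.gcd a b ∈ q.divisors := by
  intro a ha b _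
  rw [Nat.mem_divisors] at *
  exact ⟨(Nat.gcd_dvd_left a b).trans ha.1, ha.2⟩

theorem lcm_mem_divisors {q : ℕ} : ∀ a ∈ q.divisors, ∀ b ∈ q.divisors,
    Nat.lcm a b ∈ q.divisors := by
  intro a ha b hb
  rw [Nat.mem_divisors] at *
  exact ⟨Nat.lcm_dvd ha.1 hb.1, ha.2⟩

/-- Independence of two outputs, phrased through test functions `f`; this avoids grouping outputs by
their divisor. -/
theorem sum_prod_eq_sum_combine {q : ℕ} {op : ℕ → ℕ → ℕ} {ι : Type} [Fintype ι]
    (hop : ∀ a ∈ q.divisors, ∀ b ∈ q.divisors, op a b ∈ q.divisors)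
    {e : ℕ → ℝ} {d : ι → ℕ} {w : ι → ℝ}
    (h : ∀ f : ℕ → ℝ, ∑ y, w y * f (d y) = ∑ m ∈ q.divisors, e m * f m) (f : ℕ → ℝ) :
    ∑ y : ι × ι, w y.1 * w y.2 * f (op (d y.1) (d y.2))
      = ∑ m ∈ q.divisors, combine q op e m * f m := by
  rw [sum_combine hop, Fintype.sum_prod_type]
  have h1 : ∀ y₁ : ι, ∑ y₂ : ι, w y₁ * w y₂ * f (op (d y₁) (d y₂))
      = w y₁ * ∑ b ∈ q.divisors, e b * f (op (d y₁) b) := by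
    intro y₁
    rw [← h fun b => f (op (d y₁) b), Finset.mul_sum]
    exact Finset.sum_congr rfl fun y₂ _ => by ring
  rw [Finset.sum_congr rfl fun y₁ _ => h1 y₁,
    h fun a => ∑ b ∈ q.divisors, e b * f (op a b)]
  refine Finset.sum_congr rfl fun a _ => ?_
  rw [Finset.mul_sum]
  exact Finset.sum_congr rfl fun b _ => by ring

theorem isErasureLike_erasureChannel (ε : ℕ → ℝ) (hε : IsProbVec q ε) :
    IsErasureLike (erasureChannel q ε hε) ε := by
  -- For uniform input, the mass `ε_d` is shared equally by the `d` residues.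
  refine ⟨fun y => y.1, fun y => ((y.2.val : ℕ) : ZMod q), fun y => ε y.1 / (y.1 : ℕ),
    fun y => Nat.dvd_of_mem_divisors y.1.2, ?_, ?_⟩
  · rintro x ⟨⟨d, hd⟩, y⟩
    have hdq := Nat.dvd_of_mem_divisors hd
    have hd0 : (d : ℝ) ≠ 0 := Nat.cast_ne_zero.mpr (Nat.pos_of_mem_divisors hd).ne'
    have : NeZero d := ⟨(Nat.pos_of_mem_divisors hd).ne'⟩
    have key : y = phi hdq x ↔ (d : ZMod q) ∣ x - ((y.val : ℕ) : ZMod q) := by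
      rw [natCast_dvd_iff hdq, dvd_val_iff_castHom_eq_zero hdq, map_sub, map_natCast,
        ZMod.natCast_zmod_val, sub_eq_zero]
      exact eq_comm
    show (if y = phi hdq x then ε d else 0) = _
    by_cases h : y = phi hdq x
    · rw [if_pos h, if_pos (key.mp h)]
      exact (div_mul_cancel₀ _ hd0).symm
    · rw [if_neg h, if_neg (mt key.mpr h)]
  · intro f
    show ∑ y : (Σ d : q.divisors, ZMod d), ε y.1 / ((y.1 : ℕ) : ℝ) * f y.1 = _
    rw [Fintype.sum_sigma, ← Finset.sum_coe_sort q.divisors fun m => ε m * f m]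
    refine Finset.sum_congr rfl fun d _ => ?_
    have hd0 : ((d : ℕ) : ℝ) ≠ 0 := Nat.cast_ne_zero.mpr (Nat.pos_of_mem_divisors d.2).ne'
    simp only [Finset.sum_const, Finset.card_univ, ZMod.card, nsmul_eq_mul]
    field_simp

omit [NeZero q] in
theorem unit_mul_natCast_dvd (γ : (ZMod q)ˣ) (a x : ZMod q) : a ∣ (γ : ZMod q) * x ↔ a ∣ x :=
  Units.dvd_mul_left

theorem mul_ite_mul_ite (P Q : Prop) [Decidable P] [Decidable Q] (a b c : ℝ) :
    c * (if P then a else 0) * (if Q then b else 0) = if P ∧ Q then c * a * b else 0 := by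
  by_cases hP : P <;> by_cases hQ : Q <;> simp [hP, hQ]

omit [NeZero q] in
/-- Two congruences `a ∣ v + γ u - r`, `b ∣ u - s` in `u` are solvable iff
`gcd(a, b) ∣ v - (r - γ s)`. -/
theorem exists_congruence_iff (γ : (ZMod q)ˣ) (a b : ℕ) (v r s : ZMod q) :
    ((Nat.gcd a b : ℕ) : ZMod q) ∣ v - (r - γ * s) ↔
      ∃ u : ZMod q, (a : ZMod q) ∣ v + γ * u - r ∧ (b : ZMod q) ∣ u - s := by
  rw [natCast_gcd_dvd_iff]
  constructor
  · rintro ⟨t, h1, h2⟩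
    refine ⟨s + ((γ⁻¹ : (ZMod q)ˣ) : ZMod q) * t, ?_, ?_⟩
    · have : v + γ * (s + ((γ⁻¹ : (ZMod q)ˣ) : ZMod q) * t) - r = v - (r - γ * s) + t := by
        rw [mul_add, Units.mul_inv_cancel_left]; ring
      rwa [this]
    · rw [add_sub_cancel_left]
      exact h2.mul_left _
  · rintro ⟨u, h1, h2⟩
    refine ⟨γ * (u - s), ?_, h2.mul_left _⟩
    have : v - (r - γ * s) + γ * (u - s) = v + γ * u - r := by ring
    rwa [this]

omit [NeZero q] in
theorem congruence_iff_of_solution (γ : (ZMod q)ˣ) {a b : ℕ} {v r s u₀ : ZMod q}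
    (h1 : (a : ZMod q) ∣ v + γ * u₀ - r) (h2 : (b : ZMod q) ∣ u₀ - s) (u : ZMod q) :
    ((a : ZMod q) ∣ v + γ * u - r ∧ (b : ZMod q) ∣ u - s) ↔
      ((a : ZMod q) ∣ u - u₀ ∧ (b : ZMod q) ∣ u - u₀) := by
  have e1 : v + γ * u - r = γ * (u - u₀) + (v + γ * u₀ - r) := by ring
  have e2 : u - s = (u - u₀) + (u₀ - s) := by ring
  rw [e1, dvd_add_left h1, e2, dvd_add_left h2, unit_mul_natCast_dvd]

/-- For compatible `u₁`, the admissible `u₂` form a coset of size `q / lcm`. The identity `gcd * lcm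
= d₁ * d₂` turns the resulting count into the likelihood `w₁ w₂ gcd`. -/
theorem IsErasureLike.minus (γ : (ZMod q)ˣ) {W : Channel (ZMod q)} {e : ℕ → ℝ}
    (h : IsErasureLike W e) :
    IsErasureLike (minus (fun a b => a + (γ : ZMod q) * b) W) (combine q Nat.gcd e) := by
  classical
  obtain ⟨d, r, w, hd, hW, hf⟩ := h
  have hq : (q : ℝ) ≠ 0 := Nat.cast_ne_zero.mpr (NeZero.ne q)
  refine ⟨fun y => Nat.gcd (d y.1) (d y.2), fun y => r y.1 - γ * r y.2,
    fun y => w y.1 * w y.2, fun y => (Nat.gcd_dvd_left _ _).trans (hd y.1), ?_,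
    sum_prod_eq_sum_combine gcd_mem_divisors hf⟩
  rintro v ⟨y₁, y₂⟩
  have hterm : ∀ u : ZMod q,
      1 / (Fintype.card (ZMod q) : ℝ) * W.prob (v + γ * u) y₁ * W.prob u y₂
        = if (d y₁ : ZMod q) ∣ v + γ * u - r y₁ ∧ (d y₂ : ZMod q) ∣ u - r y₂ then
            1 / (q : ℝ) * (w y₁ * d y₁) * (w y₂ * d y₂) else 0 := by
    intro u
    rw [hW, hW, ZMod.card, mul_ite_mul_ite]
  show ∑ u : ZMod q, 1 / (Fintype.card (ZMod q) : ℝ) * W.prob (v + γ * u) y₁ * W.prob u y₂ = _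
  rw [Finset.sum_congr rfl fun u _ => hterm u]
  split_ifs with hg
  · obtain ⟨u₀, h1, h2⟩ := (exists_congruence_iff γ _ _ v _ _).mp hg
    simp only [congruence_iff_of_solution γ h1 h2]
    rw [sum_ite_and_natCast_dvd (hd y₁) (hd y₂)]
    have hl : ((Nat.lcm (d y₁) (d y₂) : ℕ) : ℝ) ≠ 0 := Nat.cast_ne_zero.mpr
      (Nat.pos_of_dvd_of_pos (Nat.lcm_dvd (hd y₁) (hd y₂)) (Nat.pos_of_neZero q)).ne'
    have hgl : ((Nat.gcd (d y₁) (d y₂) : ℕ) : ℝ) * (Nat.lcm (d y₁) (d y₂) : ℕ) = d y₁ * d y₂ := by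
      exact_mod_cast Nat.gcd_mul_lcm (d y₁) (d y₂)
    field_simp
    linear_combination -(w y₁ * w y₂) * hgl
  · refine Finset.sum_eq_zero fun u _ => if_neg fun hu => hg ?_
    exact (exists_congruence_iff γ _ _ v _ _).mpr ⟨u, hu⟩

/-- With `u₁` known, the solutions `u₂` form one coset modulo the lcm, or there are none. A
proportion `1 / gcd` of the values `u₁` is compatible, which accounts for the factor `gcd / q` in
the output weights. -/
theorem IsErasureLike.plus (γ : (ZMod q)ˣ) {W : Channel (ZMod q)} {e : ℕ → ℝ}
    (h : IsErasureLike W e) :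
    IsErasureLike (plus (fun a b => a + (γ : ZMod q) * b) W) (combine q Nat.lcm e) := by
  classical
  obtain ⟨d, r, w, hd, hW, hf⟩ := h
  have hq : (q : ℝ) ≠ 0 := Nat.cast_ne_zero.mpr (NeZero.ne q)
  have hdg : ∀ y₁ y₂, Nat.gcd (d y₁) (d y₂) ∣ q := fun y₁ y₂ =>
    (Nat.gcd_dvd_left _ _).trans (hd y₁)
  -- A solution serves as coset representative. Incompatible outputs get the arbitrary value 0,
  -- harmless because their weight is zero.
  have hr : ∀ y : (W.Out × W.Out) × ZMod q, ∃ u₀ : ZMod q,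
      ((Nat.gcd (d y.1.1) (d y.1.2) : ℕ) : ZMod q) ∣ y.2 - (r y.1.1 - γ * r y.1.2) →
      (d y.1.1 : ZMod q) ∣ y.2 + γ * u₀ - r y.1.1 ∧ (d y.1.2 : ZMod q) ∣ u₀ - r y.1.2 := by
    intro y
    by_cases hg : ((Nat.gcd (d y.1.1) (d y.1.2) : ℕ) : ZMod q) ∣ y.2 - (r y.1.1 - γ * r y.1.2)
    · obtain ⟨u₀, hu⟩ := (exists_congruence_iff γ _ _ y.2 _ _).mp hg
      exact ⟨u₀, fun _ => hu⟩
    · exact ⟨0, fun h => absurd h hg⟩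
  choose r' hr' using hr
  refine ⟨fun y => Nat.lcm (d y.1.1) (d y.1.2), r',
    fun y => if ((Nat.gcd (d y.1.1) (d y.1.2) : ℕ) : ZMod q) ∣ y.2 - (r y.1.1 - γ * r y.1.2) then
      (Nat.gcd (d y.1.1) (d y.1.2) : ℕ) / (q : ℝ) * (w y.1.1 * w y.1.2) else 0,
    fun y => Nat.lcm_dvd (hd _) (hd _), ?_, ?_⟩
  · rintro u ⟨⟨y₁, y₂⟩, v⟩
    have hterm : 1 / (Fintype.card (ZMod q) : ℝ) * W.prob (v + γ * u) y₁ * W.prob u y₂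
        = if (d y₁ : ZMod q) ∣ v + γ * u - r y₁ ∧ (d y₂ : ZMod q) ∣ u - r y₂ then
            1 / (q : ℝ) * (w y₁ * d y₁) * (w y₂ * d y₂) else 0 := by
      rw [hW, hW, ZMod.card, mul_ite_mul_ite]
    show 1 / (Fintype.card (ZMod q) : ℝ) * W.prob (v + γ * u) y₁ * W.prob u y₂ = _
    rw [hterm]
    have hr0 := hr' ((y₁, y₂), v)
    dsimp only at hr0 ⊢
    by_cases hg : ((Nat.gcd (d y₁) (d y₂) : ℕ) : ZMod q) ∣ v - (r y₁ - γ * r y₂)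
    · obtain ⟨h1, h2⟩ := hr0 hg
      simp only [congruence_iff_of_solution γ h1 h2, ← natCast_lcm_dvd_iff (hd y₁) (hd y₂),
        if_pos hg]
      have hgl : ((Nat.gcd (d y₁) (d y₂) : ℕ) : ℝ) * (Nat.lcm (d y₁) (d y₂) : ℕ)
          = d y₁ * d y₂ := by
        exact_mod_cast Nat.gcd_mul_lcm (d y₁) (d y₂)
      congr 1
      field_simp
      linear_combination -(w y₁ * w y₂) * hgl
    · rw [if_neg hg, if_neg fun hu => hg ((exists_congruence_iff γ _ _ v _ _).mpr ⟨u, hu⟩)]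
      simp
  · intro f
    refine Eq.trans ?_ (sum_prod_eq_sum_combine lcm_mem_divisors hf f)
    refine (Fintype.sum_prod_type (α₁ := W.Out × W.Out) (α₂ := ZMod q) _).trans ?_
    refine Finset.sum_congr rfl fun y _ => ?_
    dsimp only
    rw [← Finset.sum_mul]
    congr 1
    have h0 := sum_ite_natCast_dvd (hdg y.1 y.2) (Equiv.subRight (r y.1 - γ * r y.2))
      ((Nat.gcd (d y.1) (d y.2) : ℕ) / (q : ℝ) * (w y.1 * w y.2))
    refine h0.trans ?_
    have hl : ((Nat.gcd (d y.1) (d y.2) : ℕ) : ℝ) ≠ 0 := Nat.cast_ne_zero.mpr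
      (Nat.pos_of_dvd_of_pos (hdg y.1 y.2) (Nat.pos_of_neZero q)).ne'
    field_simp

theorem epsSeq_succ (q : ℕ) (ε : ℕ → ℝ) (n : ℕ) (s : Fin (n + 1) → Bool) :
    epsSeq q ε (n + 1) s
      = combine q (if s (Fin.last n) then Nat.lcm else Nat.gcd) (epsSeq q ε n (Fin.init s)) := by
  funext d
  cases h : s (Fin.last n) <;> simp [epsSeq, combine, h]

theorem isErasureLike_synthetic (γ : (ZMod q)ˣ) (ε : ℕ → ℝ) (hε : IsProbVec q ε) :
    ∀ (n : ℕ) (s : Fin n → Bool),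
      IsErasureLike (synthetic (fun a b => a + (γ : ZMod q) * b) (erasureChannel q ε hε) n s)
        (epsSeq q ε n s)
  | 0, _ => isErasureLike_erasureChannel ε hε
  | n + 1, s => by
    have ih := isErasureLike_synthetic γ ε hε n (Fin.init s)
    rw [epsSeq_succ, synthetic]
    cases s (Fin.last n)
    · exact ih.minus γ
    · exact ih.plus γ

theorem IsErasureLike.symCapacity_eq {W : Channel (ZMod q)} {e : ℕ → ℝ}
    (h : IsErasureLike W e) (b : ℝ) :
    symCapacity b W = ∑ m ∈ q.divisors, e m * Real.logb b m := by
  classical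
  obtain ⟨d, r, w, hd, hW, hf⟩ := h
  have hq : (q : ℝ) ≠ 0 := Nat.cast_ne_zero.mpr (NeZero.ne q)
  rw [← hf fun m => Real.logb b m]
  refine symCapacity_eq_of_two_valued b W w (fun y => d y) ?_ ?_
  · intro x y
    rw [hW]
    split_ifs <;> simp
  · intro y
    have hd0 : (d y : ℝ) ≠ 0 :=
      Nat.cast_ne_zero.mpr (Nat.pos_of_dvd_of_pos (hd y) (Nat.pos_of_neZero q)).ne'
    simp only [hW, ZMod.card]
    rw [← Finset.mul_sum]
    have h0 := sum_ite_natCast_dvd (hd y) (Equiv.subRight (r y)) (w y * d y)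
    rw [show (∑ x : ZMod q, if (d y : ZMod q) ∣ x - r y then w y * d y else 0) = _ from h0]
    field_simp

/-- A coset modulo `d y` meets a coset of `N` in nothing or in a coset modulo the lcm with the
index. The likelihoods are thus again two-valued, with `gcd(d y, N.index)` in place of `d y`. -/
theorem IsErasureLike.symCapacity_homChannel_eq {W : Channel (ZMod q)} {e : ℕ → ℝ}
    (h : IsErasureLike W e) (N : AddSubgroup (ZMod q)) (b : ℝ) :
    symCapacity b (homChannel W N)
      = ∑ m ∈ q.divisors, e m * Real.logb b (Nat.gcd m N.index : ℕ) := by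
  classical
  obtain ⟨d, r, w, hd, hW, hf⟩ := h
  have hq : (q : ℝ) ≠ 0 := Nat.cast_ne_zero.mpr (NeZero.ne q)
  have hNq : N.index ∣ q := by simpa using N.index_dvd_card
  have hcard : (Nat.card N : ℝ) * N.index = q := by
    have := N.card_mul_index
    rw [Nat.card_zmod] at this
    exact_mod_cast this
  have hN0 : (Nat.card N : ℝ) ≠ 0 := Nat.cast_ne_zero.mpr Nat.card_pos.ne'
  have hi0 : (N.index : ℝ) ≠ 0 := fun h => hq (by rw [← hcard, h, mul_zero])
  rw [← hf fun m => Real.logb b (Nat.gcd m N.index : ℕ)]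
  refine symCapacity_eq_of_two_valued b (homChannel W N) w
    (fun y => (Nat.gcd (d y) N.index : ℕ)) ?_ ?_
  · intro a (y : W.Out)
    obtain ⟨a, rfl⟩ := QuotientAddGroup.mk_surjective a
    have hprob : (homChannel W N).prob (QuotientAddGroup.mk a) y = 1 / (Nat.card N : ℝ) *
        ∑ x : ZMod q, if (d y : ZMod q) ∣ x - r y ∧ (N.index : ZMod q) ∣ x - a then
          w y * d y else 0 := by
      show 1 / (Nat.card N : ℝ) * ∑ x ∈ (Set.toFinite {x : ZMod q |
        (QuotientAddGroup.mk x : ZMod q ⧸ N) = QuotientAddGroup.mk a}).toFinset, W.prob x y = _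
      congr 1
      rw [← Finset.sum_filter_add_sum_filter_not Finset.univ
        (fun x : ZMod q => (N.index : ZMod q) ∣ x - a)]
      rw [Finset.sum_eq_zero (s := Finset.univ.filter
        fun x : ZMod q => ¬ (N.index : ZMod q) ∣ x - a), add_zero]
      · refine Finset.sum_congr ?_ ?_
        · ext x
          simp only [Set.Finite.mem_toFinset, Set.mem_ofPred_eq, Finset.mem_filter,
            Finset.mem_univ, true_and]
          rw [← mem_iff_index_natCast_dvd, eq_comm, QuotientAddGroup.eq, neg_add_eq_sub]
        · intro x hx
          rw [hW]
          simp [(Finset.mem_filter.mp hx).2]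
      · intro x hx
        rw [if_neg fun hx' => (Finset.mem_filter.mp hx).2 hx'.2]
    rw [hprob]
    by_cases hex : ∃ x₀ : ZMod q, (d y : ZMod q) ∣ x₀ - r y ∧ (N.index : ZMod q) ∣ x₀ - a
    · right
      obtain ⟨x₀, h1, h2⟩ := hex
      have hiff : ∀ x : ZMod q, ((d y : ZMod q) ∣ x - r y ∧ (N.index : ZMod q) ∣ x - a) ↔
          ((d y : ZMod q) ∣ x - x₀ ∧ (N.index : ZMod q) ∣ x - x₀) := by
        intro x
        rw [← sub_add_sub_cancel x x₀ (r y), dvd_add_left h1, ← sub_add_sub_cancel x x₀ a,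
          dvd_add_left h2]
      simp only [hiff]
      rw [sum_ite_and_natCast_dvd (hd y) hNq]
      have hl : ((Nat.lcm (d y) N.index : ℕ) : ℝ) ≠ 0 := Nat.cast_ne_zero.mpr
        (Nat.pos_of_dvd_of_pos (Nat.lcm_dvd (hd y) hNq) (Nat.pos_of_neZero q)).ne'
      have hgl : ((Nat.gcd (d y) N.index : ℕ) : ℝ) * (Nat.lcm (d y) N.index : ℕ)
          = d y * N.index := by
        exact_mod_cast Nat.gcd_mul_lcm (d y) N.index
      rw [← hcard]
      field_simp
      linear_combination -(w y) * hgl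
    · left
      rw [Finset.sum_eq_zero, mul_zero]
      intro x _
      exact if_neg fun hx => hex ⟨x, hx⟩
  · intro (y : W.Out)
    have hd0 : (d y : ℝ) ≠ 0 :=
      Nat.cast_ne_zero.mpr (Nat.pos_of_dvd_of_pos (hd y) (Nat.pos_of_neZero q)).ne'
    have hfib : ∑ a : ZMod q ⧸ N, ∑ x ∈ (Set.toFinite {x : ZMod q |
        (QuotientAddGroup.mk x : ZMod q ⧸ N) = a}).toFinset, W.prob x y
          = ∑ x : ZMod q, W.prob x y := by
      rw [← Finset.sum_fiberwise Finset.univ (fun x : ZMod q => (QuotientAddGroup.mk x : ZMod q ⧸ N))]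
      refine Finset.sum_congr rfl fun a _ => Finset.sum_congr ?_ fun _ _ => rfl
      ext x
      simp
    have hXN : (Fintype.card (ZMod q ⧸ N) : ℝ) = N.index := by
      rw [AddSubgroup.index, Nat.card_eq_fintype_card]
    show ∑ a : ZMod q ⧸ N, 1 / (Fintype.card (ZMod q ⧸ N) : ℝ) * (1 / (Nat.card N : ℝ) *
      ∑ x ∈ (Set.toFinite {x : ZMod q |
        (QuotientAddGroup.mk x : ZMod q ⧸ N) = a}).toFinset, W.prob x y) = _
    rw [← Finset.mul_sum, ← Finset.mul_sum, hfib, hXN]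
    simp only [hW]
    have h0 := sum_ite_natCast_dvd (hd y) (Equiv.subRight (r y)) (w y * d y)
    rw [show (∑ x : ZMod q, if (d y : ZMod q) ∣ x - r y then w y * d y else 0) = _ from h0,
      ← hcard]
    field_simp

end ErasureLike

/-! ### Probability vectors on divisors: tail masses and concentration -/

section ProbVec

variable {q : ℕ}

theorem IsProbVec.combine {e : ℕ → ℝ} (he : IsProbVec q e) {op : ℕ → ℕ → ℕ}
    (hop : ∀ a ∈ q.divisors, ∀ b ∈ q.divisors, op a b ∈ q.divisors) :
    IsProbVec q (combine q op e) := by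
  constructor
  · intro d _
    refine Finset.sum_nonneg fun a ha => Finset.sum_nonneg fun b hb => ?_
    split_ifs
    · exact mul_nonneg (he.nonneg a ha) (he.nonneg b hb)
    · exact le_rfl
  · have h := sum_combine hop e fun _ => 1
    simp only [mul_one] at h
    rw [h, ← Finset.sum_mul_sum, he.sum_eq_one, one_mul]

theorem isProbVec_epsSeq {ε : ℕ → ℝ} (hε : IsProbVec q ε) :
    ∀ (n : ℕ) (s : Fin n → Bool), IsProbVec q (epsSeq q ε n s)
  | 0, _ => hε
  | n + 1, s => by
    have ih := isProbVec_epsSeq hε n (Fin.init s)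
    rw [epsSeq_succ]
    cases s (Fin.last n)
    · exact ih.combine gcd_mem_divisors
    · exact ih.combine lcm_mem_divisors

theorem IsProbVec.le_one {e : ℕ → ℝ} (he : IsProbVec q e) {d : ℕ} (hd : d ∈ q.divisors) :
    e d ≤ 1 :=
  he.sum_eq_one ▸ Finset.single_le_sum he.nonneg hd

/-- The mass that `e` gives to the multiples of `m`. -/
def tailMass (q : ℕ) (e : ℕ → ℝ) (m : ℕ) : ℝ :=
  ∑ d ∈ q.divisors, e d * if m ∣ d then 1 else 0

theorem IsProbVec.tailMass_nonneg {e : ℕ → ℝ} (he : IsProbVec q e) (m : ℕ) :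
    0 ≤ tailMass q e m :=
  Finset.sum_nonneg fun d hd => mul_nonneg (he.nonneg d hd) (by split_ifs <;> norm_num)

theorem IsProbVec.tailMass_le_one {e : ℕ → ℝ} (he : IsProbVec q e) (m : ℕ) :
    tailMass q e m ≤ 1 := by
  rw [← he.sum_eq_one]
  refine Finset.sum_le_sum fun d hd => ?_
  have := he.nonneg d hd
  split_ifs <;> simp [this]

/-- `m` divides a gcd exactly when it divides both independent samples. -/
theorem tailMass_combine_gcd (e : ℕ → ℝ) (m : ℕ) :
    tailMass q (combine q Nat.gcd e) m = tailMass q e m ^ 2 := by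
  rw [tailMass, sum_combine gcd_mem_divisors, tailMass, sq, Finset.sum_mul_sum]
  refine Finset.sum_congr rfl fun a _ => Finset.sum_congr rfl fun b _ => ?_
  by_cases ha : m ∣ a <;> by_cases hb : m ∣ b <;> simp [Nat.dvd_gcd_iff, ha, hb]

/-- By inclusion–exclusion the left side is the probability that `m` divides at least one sample.
Only an inequality holds: if `m` is not a prime power it may divide the lcm without dividing either.
-/
theorem IsProbVec.le_tailMass_combine_lcm {e : ℕ → ℝ} (he : IsProbVec q e) (m : ℕ) :
    2 * tailMass q e m - tailMass q e m ^ 2 ≤ tailMass q (PolarErasure.combine q Nat.lcm e) m := by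
  have hrow : tailMass q e m = ∑ a ∈ q.divisors, ∑ b ∈ q.divisors,
      e a * e b * if m ∣ a then 1 else 0 := by
    rw [tailMass]
    refine Finset.sum_congr rfl fun a _ => ?_
    rw [← Finset.sum_mul, ← Finset.mul_sum, he.sum_eq_one, mul_one]
  have hcol : tailMass q e m = ∑ a ∈ q.divisors, ∑ b ∈ q.divisors,
      e a * e b * if m ∣ b then 1 else 0 := by
    rw [hrow, Finset.sum_comm]
    exact Finset.sum_congr rfl fun a _ => Finset.sum_congr rfl fun b _ => by ring
  have hsq : tailMass q e m ^ 2 = ∑ a ∈ q.divisors, ∑ b ∈ q.divisors,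
      e a * e b * ((if m ∣ a then 1 else 0) * if m ∣ b then 1 else 0) := by
    rw [tailMass, sq, Finset.sum_mul_sum]
    exact Finset.sum_congr rfl fun a _ => Finset.sum_congr rfl fun b _ => by ring
  rw [hsq, two_mul]
  nth_rewrite 1 [hrow]
  rw [hcol, tailMass, sum_combine lcm_mem_divisors, ← Finset.sum_add_distrib,
    ← Finset.sum_sub_distrib]
  refine Finset.sum_le_sum fun a ha => ?_
  rw [← Finset.sum_add_distrib, ← Finset.sum_sub_distrib]
  refine Finset.sum_le_sum fun b hb => ?_
  rw [← mul_add, ← mul_sub]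
  refine mul_le_mul_of_nonneg_left ?_ (mul_nonneg (he.nonneg a ha) (he.nonneg b hb))
  have h1 : m ∣ a → m ∣ Nat.lcm a b := fun h => h.trans (Nat.dvd_lcm_left a b)
  have h2 : m ∣ b → m ∣ Nat.lcm a b := fun h => h.trans (Nat.dvd_lcm_right a b)
  by_cases ha : m ∣ a <;> by_cases hb : m ∣ b <;>
    simp only [ha, hb, h1, h2, if_true, if_false] <;> norm_num
  split_ifs <;> norm_num

/-- The probability that two independent samples from `e` differ. -/
def spread (q : ℕ) (e : ℕ → ℝ) : ℝ := ∑ d ∈ q.divisors, e d * (1 - e d)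

/-- Two distinct samples are separated by divisibility by one of them. -/
theorem IsProbVec.spread_le {e : ℕ → ℝ} (he : IsProbVec q e) :
    spread q e ≤ 2 * ∑ m ∈ q.divisors, tailMass q e m * (1 - tailMass q e m) := by
  have hspread : spread q e = ∑ a ∈ q.divisors, ∑ b ∈ q.divisors,
      e a * e b * if a = b then 0 else 1 := by
    refine Finset.sum_congr rfl fun a ha => ?_
    have : ∀ b ∈ q.divisors, e a * e b * (if a = b then (0 : ℝ) else 1)
        = e a * e b - if a = b then e a * e b else 0 := by
      intro b _
      split_ifs <;> ring
    rw [Finset.sum_congr rfl this, Finset.sum_sub_distrib, ← Finset.mul_sum, he.sum_eq_one,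
      Finset.sum_ite_eq, if_pos ha]
    ring
  have hcompl : ∀ m, 1 - tailMass q e m = ∑ b ∈ q.divisors, e b * if m ∣ b then 0 else 1 := by
    intro m
    rw [sub_eq_iff_eq_add, tailMass, ← Finset.sum_add_distrib]
    refine he.sum_eq_one.symm.trans (Finset.sum_congr rfl fun b _ => ?_)
    split_ifs <;> ring
  have hprod : ∀ m, tailMass q e m * (1 - tailMass q e m)
      = ∑ a ∈ q.divisors, ∑ b ∈ q.divisors,
        e a * e b * ((if m ∣ a then 1 else 0) * if m ∣ b then 0 else 1) := by
    intro m
    rw [hcompl, tailMass, Finset.sum_mul_sum]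
    exact Finset.sum_congr rfl fun a _ => Finset.sum_congr rfl fun b _ => by ring
  -- Symmetrising in the two samples produces the factor 2 and allows either of them to be the
  -- multiple of `m`.
  have hswap : ∀ m, tailMass q e m * (1 - tailMass q e m)
      = ∑ a ∈ q.divisors, ∑ b ∈ q.divisors,
        e a * e b * ((if m ∣ b then 1 else 0) * if m ∣ a then 0 else 1) := by
    intro m
    rw [hprod, Finset.sum_comm]
    exact Finset.sum_congr rfl fun a _ => Finset.sum_congr rfl fun b _ => by ring
  have hsum : 2 * ∑ m ∈ q.divisors, tailMass q e m * (1 - tailMass q e m)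
      = ∑ a ∈ q.divisors, ∑ b ∈ q.divisors, e a * e b * ∑ m ∈ q.divisors,
        (((if m ∣ a then 1 else 0) * if m ∣ b then 0 else 1)
          + (if m ∣ b then 1 else 0) * if m ∣ a then 0 else 1) := by
    rw [two_mul]
    nth_rewrite 1 [Finset.sum_congr rfl fun m _ => hprod m]
    rw [Finset.sum_congr rfl fun m _ => hswap m, ← Finset.sum_add_distrib]
    simp only [← Finset.sum_add_distrib, ← mul_add]
    rw [Finset.sum_comm]
    refine Finset.sum_congr rfl fun a _ => ?_
    rw [Finset.sum_comm]
    exact Finset.sum_congr rfl fun b _ => (Finset.mul_sum _ _ _).symm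
  rw [hspread, hsum]
  refine Finset.sum_le_sum fun a ha => Finset.sum_le_sum fun b hb =>
    mul_le_mul_of_nonneg_left ?_ (mul_nonneg (he.nonneg a ha) (he.nonneg b hb))
  have hnn : ∀ m ∈ q.divisors, (0 : ℝ) ≤ ((if m ∣ a then 1 else 0) * if m ∣ b then 0 else 1)
      + (if m ∣ b then 1 else 0) * if m ∣ a then 0 else 1 := by
    intro m _
    split_ifs <;> norm_num
  by_cases hab : a = b
  · rw [if_pos hab]
    exact Finset.sum_nonneg hnn
  · rw [if_neg hab]
    -- If `a ∣ b`, then `m = b` separates the two; otherwise `m = a` does.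
    by_cases h : a ∣ b
    · have h' : ¬ b ∣ a := fun h' => hab (Nat.dvd_antisymm h h')
      refine le_trans ?_ (Finset.single_le_sum hnn hb)
      simp [h']
    · refine le_trans ?_ (Finset.single_le_sum hnn ha)
      simp [h]

theorem IsProbVec.spread_nonneg {e : ℕ → ℝ} (he : IsProbVec q e) : 0 ≤ spread q e :=
  Finset.sum_nonneg fun d hd => mul_nonneg (he.nonneg d hd) (sub_nonneg.mpr (he.le_one hd))

/-- The most likely divisor `d` satisfies `1 - e d ≤ τ(q) · spread e`. -/
theorem IsProbVec.exists_one_sub_le_spread {e : ℕ → ℝ} (he : IsProbVec q e) :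
    ∃ d ∈ q.divisors, 1 - e d ≤ q.divisors.card * spread q e := by
  have hne : q.divisors.Nonempty := by
    rw [Finset.nonempty_iff_ne_empty]
    intro h
    have := he.sum_eq_one
    simp [h] at this
  obtain ⟨d, hd, hmax⟩ := Finset.exists_max_image q.divisors e hne
  refine ⟨d, hd, ?_⟩
  -- The largest mass is at least the mean mass `1 / τ(q)`.
  have h1 : 1 ≤ q.divisors.card * e d := by
    rw [← he.sum_eq_one, ← nsmul_eq_mul]
    exact Finset.sum_le_card_nsmul _ _ _ hmax
  have h2 : e d * (1 - e d) ≤ spread q e :=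
    Finset.single_le_sum (f := fun d => e d * (1 - e d))
      (fun d hd => mul_nonneg (he.nonneg d hd) (sub_nonneg.mpr (he.le_one hd))) hd
  have h3 : 0 ≤ 1 - e d := sub_nonneg.mpr (he.le_one hd)
  calc 1 - e d ≤ (q.divisors.card * e d) * (1 - e d) := le_mul_of_one_le_left h3 h1
    _ = q.divisors.card * (e d * (1 - e d)) := by ring
    _ ≤ _ := mul_le_mul_of_nonneg_left h2 (Nat.cast_nonneg _)

/-- The mean of a function with values in `[0, 1]` is within `1 - e d` of its value at `d`. -/
theorem IsProbVec.abs_mean_sub_le {e : ℕ → ℝ} (he : IsProbVec q e) {f : ℕ → ℝ}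
    (hf : ∀ m ∈ q.divisors, 0 ≤ f m ∧ f m ≤ 1) {d : ℕ} (hd : d ∈ q.divisors) :
    |(∑ m ∈ q.divisors, e m * f m) - f d| ≤ 1 - e d := by
  have h1 : (∑ m ∈ q.divisors, e m * f m) - f d
      = ∑ m ∈ q.divisors, e m * (f m - f d) := by
    simp only [mul_sub, Finset.sum_sub_distrib]
    rw [← Finset.sum_mul, he.sum_eq_one, one_mul]
  have h2 : 1 - e d = ∑ m ∈ q.divisors, e m * if m = d then 0 else 1 := by
    have : ∀ m ∈ q.divisors, e m * (if m = d then (0 : ℝ) else 1)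
        = e m - if m = d then e m else 0 := by
      intro m _
      split_ifs <;> ring
    rw [Finset.sum_congr rfl this, Finset.sum_sub_distrib, he.sum_eq_one, Finset.sum_ite_eq',
      if_pos hd]
  rw [h1, h2]
  refine (Finset.abs_sum_le_sum_abs _ _).trans (Finset.sum_le_sum fun m hm => ?_)
  rw [abs_mul, abs_of_nonneg (he.nonneg m hm)]
  refine mul_le_mul_of_nonneg_left ?_ (he.nonneg m hm)
  split_ifs with h
  · simp [h]
  · have hm' := hf m hm
    have hd' := hf d hd
    rw [abs_le]
    constructor <;> linarith

end ProbVec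

/-! ### Recovering the dominant divisor from the two capacities -/

section Level

variable {q : ℕ}

theorem logb_mem_Icc (hq : 2 ≤ q) {m : ℕ} (hm : m ∈ q.divisors) :
    0 ≤ Real.logb q m ∧ Real.logb q m ≤ 1 := by
  have hq1 : (1 : ℝ) < q := by exact_mod_cast hq
  have hm0 := Nat.pos_of_mem_divisors hm
  constructor
  · exact Real.logb_nonneg hq1 (by exact_mod_cast hm0)
  · rw [← Real.logb_self_eq_one hq1]
    exact Real.logb_le_logb_of_le hq1 (by exact_mod_cast hm0)
      (by exact_mod_cast Nat.divisor_le hm)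

/-- The quotient `b / a` is a divisor of `q` greater than 1, hence at least the smallest prime
factor. -/
theorem logb_add_minFac_le (hq : 2 ≤ q) {a b : ℕ} (hb : b ∈ q.divisors) (hab : a ∣ b)
    (hne : a ≠ b) : Real.logb q a + Real.logb q q.minFac ≤ Real.logb q b := by
  have hq1 : (1 : ℝ) < q := by exact_mod_cast hq
  obtain ⟨k, rfl⟩ := hab
  have hb0 := Nat.pos_of_mem_divisors hb
  have ha0 : 0 < a := Nat.pos_of_mul_pos_right hb0
  have hk0 : 0 < k := Nat.pos_of_mul_pos_left hb0
  have hk : 2 ≤ k := by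
    rcases Nat.lt_or_ge k 2 with h | h
    · have : k = 1 := by omega
      exact absurd (by rw [this, mul_one]) hne
    · exact h
  have hkq : k ∣ q := (Dvd.intro_left a rfl).trans (Nat.dvd_of_mem_divisors hb)
  have hmin : q.minFac ≤ k := Nat.minFac_le_of_dvd hk hkq
  rw [Nat.cast_mul, Real.logb_mul (by exact_mod_cast ha0.ne') (by exact_mod_cast hk0.ne')]
  gcongr
  · exact_mod_cast Nat.minFac_pos q

/-- A pair of levels close to `(log d, log d)` identifies the divisor `d`. -/
theorem IsProbVec.abs_indicator_sub_le (hq : 2 ≤ q) {e : ℕ → ℝ} (he : IsProbVec q e) {d : ℕ}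
    (hd : d ∈ q.divisors) {δ : ℝ} (hδ : 0 < δ) (hδ' : δ < Real.logb q q.minFac) (P : Prop)
    [Decidable P]
    (hP : P ↔ |∑ m ∈ q.divisors, e m * Real.logb q m - Real.logb q d| < δ ∧
      |∑ m ∈ q.divisors, e m * Real.logb q (Nat.gcd m d : ℕ) - Real.logb q d| < δ) :
    |(if P then 1 else 0) - e d| ≤
      (1 + 1 / δ + 1 / (Real.logb q q.minFac - δ)) * (q.divisors.card * spread q e) := by
  set S := (q.divisors.card : ℝ) * spread q e with hS
  set L := Real.logb q q.minFac with hL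
  have hS0 : 0 ≤ S := mul_nonneg (Nat.cast_nonneg _) he.spread_nonneg
  have hLδ : 0 < L - δ := by linarith
  have hf : ∀ m ∈ q.divisors, 0 ≤ Real.logb q m ∧ Real.logb q m ≤ 1 :=
    fun m hm => logb_mem_Icc hq hm
  have hg : ∀ m ∈ q.divisors, 0 ≤ Real.logb q (Nat.gcd m d : ℕ) ∧
      Real.logb q (Nat.gcd m d : ℕ) ≤ 1 :=
    fun m hm => logb_mem_Icc hq (gcd_mem_divisors m hm d hd)
  have b1 : 0 ≤ 1 / δ * S := by positivity
  have b2 : 0 ≤ 1 / (L - δ) * S := by positivity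
  have he0 := he.nonneg d hd
  have he1 := he.le_one hd
  have hexp : (1 + 1 / δ + 1 / (L - δ)) * S = S + 1 / δ * S + 1 / (L - δ) * S := by ring
  rw [hexp]
  -- Let `d'` carry the dominant mass. If `P` holds exactly when `d' = d`, the error is at most `S`.
  -- If `P` fails although `d' = d`, then `S ≥ δ`; if `P` holds although `d' ≠ d`, then `S ≥ L - δ`.
  -- An error of at most 1 is then absorbed by `S / δ` or `S / (L - δ)`.
  obtain ⟨d', hd', hmass⟩ := he.exists_one_sub_le_spread
  rw [← hS] at hmass
  have hfd := he.abs_mean_sub_le hf hd'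
  have hgd := he.abs_mean_sub_le hg hd'
  by_cases hdd : d' = d
  · subst hdd
    split_ifs with h
    · rw [abs_of_nonneg (by linarith)]
      linarith
    · have hδS : δ ≤ S := by
        by_contra hlt
        rw [Nat.gcd_self] at hgd
        exact h (hP.mpr ⟨by linarith, by linarith⟩)
      have : 1 ≤ 1 / δ * S := by
        rw [one_div_mul_eq_div, le_div_iff₀ hδ]
        linarith
      rw [zero_sub, abs_neg, abs_of_nonneg he0]
      linarith
  · have hpair : e d + e d' ≤ 1 := by
      rw [← he.sum_eq_one, ← Finset.sum_pair (Ne.symm hdd)]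
      refine Finset.sum_le_sum_of_subset_of_nonneg ?_ fun m hm _ => he.nonneg m hm
      intro m hm
      rcases Finset.mem_insert.mp hm with rfl | hm
      · exact hd
      · rwa [Finset.mem_singleton.mp hm]
    split_ifs with h
    · have hLS : L - δ ≤ S := by
        obtain ⟨h1, h2⟩ := hP.mp h
        rw [abs_lt] at h1 h2
        rw [abs_le] at hfd hgd
        -- Either `d` properly divides `d'` and the first level is too high by `L`, or `gcd(d', d)`
        -- properly divides `d` and the second is too low by `L`.
        by_cases hgcd : Nat.gcd d' d = d
        · have := logb_add_minFac_le hq hd' (hgcd ▸ Nat.gcd_dvd_left d' d) (Ne.symm hdd)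
          linarith
        · have := logb_add_minFac_le hq hd (Nat.gcd_dvd_right d' d) hgcd
          linarith
      have : 1 ≤ 1 / (L - δ) * S := by
        rw [one_div_mul_eq_div, le_div_iff₀ hLδ]
        linarith
      rw [abs_of_nonneg (by linarith)]
      linarith
    · rw [zero_sub, abs_neg, abs_of_nonneg he0]
      linarith

end Level

/-! ### Averages over sign sequences -/

section Average

/-- The average of `F` over all sign sequences of length `n`. -/
noncomputable def signAvg (n : ℕ) (F : (Fin n → Bool) → ℝ) : ℝ := 1 / 2 ^ n * ∑ s, F s

theorem signAvg_mono {n : ℕ} {F G : (Fin n → Bool) → ℝ} (h : ∀ s, F s ≤ G s) :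
    signAvg n F ≤ signAvg n G :=
  mul_le_mul_of_nonneg_left (Finset.sum_le_sum fun s _ => h s) (by positivity)

theorem signAvg_const (n : ℕ) (c : ℝ) : signAvg n (fun _ => c) = c := by
  simp [signAvg]

theorem signAvg_add (n : ℕ) (F G : (Fin n → Bool) → ℝ) :
    signAvg n (fun s => F s + G s) = signAvg n F + signAvg n G := by
  simp [signAvg, Finset.sum_add_distrib, mul_add]

theorem signAvg_mul_left (n : ℕ) (c : ℝ) (F : (Fin n → Bool) → ℝ) :
    signAvg n (fun s => c * F s) = c * signAvg n F := by
  simp only [signAvg, ← Finset.mul_sum]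
  ring

theorem signAvg_sum {ι : Type*} (n : ℕ) (t : Finset ι) (F : ι → (Fin n → Bool) → ℝ) :
    signAvg n (fun s => ∑ i ∈ t, F i s) = ∑ i ∈ t, signAvg n (F i) := by
  simp only [signAvg, Finset.mul_sum]
  exact Finset.sum_comm

theorem signAvg_succ (n : ℕ) (F : (Fin (n + 1) → Bool) → ℝ) :
    signAvg (n + 1) F
      = signAvg n fun s => (F (Fin.snoc s false) + F (Fin.snoc s true)) / 2 := by
  have h : ∑ s, F s = ∑ s : Fin n → Bool, (F (Fin.snoc s false) + F (Fin.snoc s true)) := by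
    rw [← (Fin.snocEquiv fun _ : Fin (n + 1) => Bool).sum_comp, Fintype.sum_prod_type,
      Fintype.sum_bool, ← Finset.sum_add_distrib]
    exact Finset.sum_congr rfl fun s _ => add_comm _ _
  rw [signAvg, signAvg, h, ← Finset.sum_div, pow_succ]
  field_simp

end Average

/-! ### Polarization and the limits -/

section Limits

variable {q : ℕ} {ε : ℕ → ℝ}

theorem epsSeq_snoc_false (n : ℕ) (s : Fin n → Bool) :
    epsSeq q ε (n + 1) (Fin.snoc s false) = combine q Nat.gcd (epsSeq q ε n s) := by
  rw [epsSeq_succ, Fin.snoc_last, Fin.init_snoc]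
  rfl

theorem epsSeq_snoc_true (n : ℕ) (s : Fin n → Bool) :
    epsSeq q ε (n + 1) (Fin.snoc s true) = combine q Nat.lcm (epsSeq q ε n s) := by
  rw [epsSeq_succ, Fin.snoc_last, Fin.init_snoc]
  rfl

/-- A monotone sequence bounded above converges. -/
theorem exists_tendsto_of_le_succ {u : ℕ → ℝ} (h : ∀ n, u n ≤ u (n + 1)) (h1 : ∀ n, u n ≤ 1) :
    ∃ l, Tendsto u atTop (𝓝 l) :=
  ⟨_, tendsto_atTop_ciSup (monotone_nat_of_le_succ h) ⟨1, by rintro _ ⟨n, rfl⟩; exact h1 n⟩⟩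

/-- The tail mass is a bounded submartingale, as `F²` and `2F - F²` have mean `F`. -/
theorem exists_tendsto_tailMass (hε : IsProbVec q ε) (m : ℕ) :
    ∃ l, Tendsto (fun n => signAvg n fun s => tailMass q (epsSeq q ε n s) m) atTop (𝓝 l) := by
  refine exists_tendsto_of_le_succ (fun n => ?_) fun n => ?_
  · rw [signAvg_succ]
    refine signAvg_mono fun s => ?_
    rw [epsSeq_snoc_false, epsSeq_snoc_true, tailMass_combine_gcd]
    have := (isProbVec_epsSeq hε n s).le_tailMass_combine_lcm m
    linarith
  · rw [← signAvg_const n 1]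
    exact signAvg_mono fun s => (isProbVec_epsSeq hε n s).tailMass_le_one m

/-- The mean of the squares of `F²` and `2F - F²` is `F² + (F(1 - F))²`. The averaged second moment
is bounded by 1 and so converges; its increments, which dominate these averages, tend to 0. -/
theorem tendsto_tailMass_variance_sq (hε : IsProbVec q ε) (m : ℕ) :
    Tendsto (fun n => signAvg n fun s =>
      (tailMass q (epsSeq q ε n s) m * (1 - tailMass q (epsSeq q ε n s) m)) ^ 2)
      atTop (𝓝 0) := by
  set u : ℕ → ℝ := fun n => signAvg n fun s => tailMass q (epsSeq q ε n s) m ^ 2 with hu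
  set v : ℕ → ℝ := fun n => signAvg n fun s =>
    (tailMass q (epsSeq q ε n s) m * (1 - tailMass q (epsSeq q ε n s) m)) ^ 2 with hv
  have hv0 : ∀ n, 0 ≤ v n := fun n =>
    mul_nonneg (by positivity) (Finset.sum_nonneg fun s _ => sq_nonneg _)
  have hstep : ∀ n, u n + v n ≤ u (n + 1) := by
    intro n
    rw [hu, hv]
    dsimp only
    rw [signAvg_succ, ← signAvg_add]
    refine signAvg_mono fun s => ?_
    rw [epsSeq_snoc_false, epsSeq_snoc_true, tailMass_combine_gcd]
    have he := isProbVec_epsSeq hε n s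
    have h := he.le_tailMass_combine_lcm m
    have h0 := he.tailMass_nonneg m
    have h1 := he.tailMass_le_one m
    generalize tailMass q (epsSeq q ε n s) m = F at *
    -- Squaring the plus-step inequality needs `F(2 - F) ≥ 0`.
    have hsq := pow_le_pow_left₀ (by nlinarith : (0 : ℝ) ≤ 2 * F - F ^ 2) h 2
    linarith [show (F ^ 2) ^ 2 + (2 * F - F ^ 2) ^ 2 = 2 * (F ^ 2 + (F * (1 - F)) ^ 2) by ring]
  obtain ⟨l, hl⟩ := exists_tendsto_of_le_succ (u := u)
    (fun n => by linarith [hstep n, hv0 n]) (fun n => by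
      rw [← signAvg_const n 1]
      refine signAvg_mono fun s => ?_
      have he := isProbVec_epsSeq hε n s
      exact pow_le_one₀ (he.tailMass_nonneg m) (he.tailMass_le_one m))
  have hdiff : Tendsto (fun n => u (n + 1) - u n) atTop (𝓝 0) := by
    simpa using (hl.comp (tendsto_add_atTop_nat 1)).sub hl
  exact squeeze_zero hv0 (fun n => by linarith [hstep n]) hdiff

theorem signAvg_sq_le (n : ℕ) (F : (Fin n → Bool) → ℝ) :
    signAvg n F ^ 2 ≤ signAvg n fun s => F s ^ 2 := by
  have h := sq_sum_le_card_mul_sum_sq (s := Finset.univ) (f := F)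
  have hc : ((Finset.univ : Finset (Fin n → Bool)).card : ℝ) = 2 ^ n := by simp
  rw [hc] at h
  rw [signAvg, signAvg, mul_pow]
  calc (1 / 2 ^ n : ℝ) ^ 2 * (∑ s, F s) ^ 2
      ≤ (1 / 2 ^ n : ℝ) ^ 2 * (2 ^ n * ∑ s, F s ^ 2) := by gcongr
    _ = _ := by field_simp

/-- Cauchy–Schwarz passes from the squares of `F(1 - F)` to `F(1 - F)` itself, and `spread_le`
bounds the spread by finitely many of these. -/
theorem tendsto_spread (hε : IsProbVec q ε) :
    Tendsto (fun n => signAvg n fun s => spread q (epsSeq q ε n s)) atTop (𝓝 0) := by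
  have hvar : ∀ m, Tendsto (fun n => signAvg n fun s =>
      tailMass q (epsSeq q ε n s) m * (1 - tailMass q (epsSeq q ε n s) m)) atTop (𝓝 0) := by
    intro m
    have h := (Real.continuous_sqrt.tendsto 0).comp (tendsto_tailMass_variance_sq hε m)
    rw [Real.sqrt_zero] at h
    refine squeeze_zero (fun n => ?_) (fun n => ?_) h
    · rw [← signAvg_const n 0]
      refine signAvg_mono fun s => ?_
      have he := isProbVec_epsSeq hε n s
      exact mul_nonneg (he.tailMass_nonneg m) (sub_nonneg.mpr (he.tailMass_le_one m))
    · exact Real.le_sqrt_of_sq_le (signAvg_sq_le n _)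
  have hsum := (tendsto_finsetSum q.divisors fun m _ => hvar m).const_mul 2
  simp only [Finset.sum_const_zero, mul_zero] at hsum
  refine squeeze_zero (fun n => ?_) (fun n => ?_) hsum
  · rw [← signAvg_const n 0]
    exact signAvg_mono fun s => (isProbVec_epsSeq hε n s).spread_nonneg
  · rw [← signAvg_sum, ← signAvg_mul_left]
    exact signAvg_mono fun s => (isProbVec_epsSeq hε n s).spread_le

theorem muAvg_eq_signAvg (d n : ℕ) : muAvg q ε d n = signAvg n fun s => epsSeq q ε n s d := rfl

/-- Convergence of the averaged tail masses gives that of the averages, by induction from the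
largest divisor downwards. -/
theorem exists_tendsto_muAvg (hε : IsProbVec q ε) {d : ℕ} (hd : d ∈ q.divisors) :
    ∃ l, Tendsto (muAvg q ε d) atTop (𝓝 l) := by
  induction hk : q - d using Nat.strong_induction_on generalizing d with
  | _ k ih =>
    have hex : ∀ m, ∃ l, m ∈ (q.divisors.filter (d ∣ ·)).erase d →
        Tendsto (muAvg q ε m) atTop (𝓝 l) := by
      intro m
      by_cases hm : m ∈ (q.divisors.filter (d ∣ ·)).erase d
      · have hm' := Finset.mem_filter.mp (Finset.mem_of_mem_erase hm)
        have hlt : d < m := lt_of_le_of_ne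
          (Nat.le_of_dvd (Nat.pos_of_mem_divisors hm'.1) hm'.2) (Finset.ne_of_mem_erase hm).symm
        have hle := Nat.divisor_le hm'.1
        obtain ⟨l, hl⟩ := ih (q - m) (by omega) hm'.1 rfl
        exact ⟨l, fun _ => hl⟩
      · exact ⟨0, fun h => absurd h hm⟩
    choose l hl using hex
    -- The tail mass at `d` is the mass of `d` plus the masses of its proper multiples, whose
    -- averages converge by induction.
    obtain ⟨t, ht⟩ := exists_tendsto_tailMass hε d
    refine ⟨_, (ht.sub (tendsto_finsetSum _ fun m hm => hl m hm)).congr fun n => ?_⟩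
    simp only [muAvg_eq_signAvg]
    rw [← signAvg_sum, sub_eq_iff_eq_add, ← signAvg_add]
    congr 1
    funext s
    rw [Finset.add_sum_erase _ (epsSeq q ε n s) (Finset.mem_filter.mpr ⟨hd, dvd_rfl⟩),
      Finset.sum_filter]
    simp [tailMass]

theorem sum_muAvg (hε : IsProbVec q ε) (n : ℕ) : ∑ d ∈ q.divisors, muAvg q ε d n = 1 := by
  simp only [muAvg_eq_signAvg]
  rw [← signAvg_sum]
  simp only [(isProbVec_epsSeq hε n _).sum_eq_one, signAvg_const]

/-- The fraction is an average of indicators, compared with `ε_d^s` sequence by sequence; the total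
error is a constant times the average spread. -/
theorem tendsto_levelFraction [NeZero q] (hq : 2 ≤ q) (hε : IsProbVec q ε) (γ : (ZMod q)ˣ)
    {δ : ℝ} (hδ : 0 < δ) (hδ' : δ < Real.logb q q.minFac) (N : AddSubgroup (ZMod q)) {l : ℝ}
    (hl : Tendsto (muAvg q ε N.index) atTop (𝓝 l)) :
    Tendsto (levelFraction γ (erasureChannel q ε hε) N (Real.logb q N.index) δ) atTop (𝓝 l) := by
  classical
  have hN : N.index ∈ q.divisors :=
    Nat.mem_divisors.mpr ⟨by simpa using N.index_dvd_card, NeZero.ne q⟩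
  set C := 1 + 1 / δ + 1 / (Real.logb q q.minFac - δ) with hC
  have hbound : ∀ n, |levelFraction γ (erasureChannel q ε hε) N (Real.logb q N.index) δ n
      - muAvg q ε N.index n|
      ≤ C * (q.divisors.card * signAvg n fun s => spread q (epsSeq q ε n s)) := by
    intro n
    rw [levelFraction, Set.ncard_eq_toFinset_card', Set.toFinset_ofPred, ← Finset.sum_boole,
      muAvg, ← mul_sub, ← Finset.sum_sub_distrib, ← signAvg_mul_left, ← signAvg_mul_left,
      abs_mul, abs_of_nonneg (by positivity : (0 : ℝ) ≤ 1 / 2 ^ n)]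
    refine mul_le_mul_of_nonneg_left ((Finset.abs_sum_le_sum_abs _ _).trans
      (Finset.sum_le_sum fun s _ => ?_)) (by positivity)
    have hlike := isErasureLike_synthetic γ ε hε n s
    refine (isProbVec_epsSeq hε n s).abs_indicator_sub_le hq hN hδ hδ' _ ?_
    rw [hlike.symCapacity_eq, hlike.symCapacity_homChannel_eq]
  have hlim : Tendsto (fun n => C * (q.divisors.card *
      signAvg n fun s => spread q (epsSeq q ε n s))) atTop (𝓝 0) := by
    simpa using ((tendsto_spread hε).const_mul (q.divisors.card : ℝ)).const_mul C
  have hdiff := squeeze_zero_norm (fun n => (Real.norm_eq_abs _).trans_le (hbound n)) hlim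
  simpa using hdiff.add hl

theorem index_ker_phi [NeZero q] {d : ℕ} (hd : d ∣ q) :
    (phi hd).toAddMonoidHom.ker.index = d := by
  have : NeZero d := ⟨(Nat.pos_of_dvd_of_pos hd (Nat.pos_of_neZero q)).ne'⟩
  rw [AddSubgroup.index_ker, AddMonoidHom.range_eq_top.mpr (ZMod.castHom_surjective hd)]
  simp

end Limits

end PolarErasure

theorem mainTheorem4 (q : ℕ) [NeZero q] (hq : 2 ≤ q) (ε : ℕ → ℝ)
    (hε : PolarErasure.IsProbVec q ε) :
    ∃ μ : ℕ → ℝ,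
      (∀ d : ℕ, d ∣ q →
        Filter.Tendsto (PolarErasure.muAvg q ε d) Filter.atTop (nhds (μ d))) ∧
      (∀ (γ : (ZMod q)ˣ) (δ : ℝ), 0 < δ → δ < Real.logb q q.minFac →
        (∀ (d : ℕ) (hd : d ∣ q),
          Filter.Tendsto
            (PolarErasure.levelFraction γ (PolarErasure.erasureChannel q ε hε)
              (PolarErasure.phi hd).toAddMonoidHom.ker (Real.logb q d) δ)
            Filter.atTop (nhds (μ d))) ∧
        (∀ N : AddSubgroup (ZMod q),
          Filter.Tendsto
            (PolarErasure.levelFraction γ (PolarErasure.erasureChannel q ε hε)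
              N (Real.logb q N.index) δ)
            Filter.atTop (nhds (μ N.index)))) ∧
      ∑ d ∈ q.divisors, μ d = 1 := by
  -- Non-divisors receive the irrelevant value 0, so that `μ` is defined on all of `ℕ`.
  have hex : ∀ d : ℕ, ∃ l, d ∣ q → Tendsto (PolarErasure.muAvg q ε d) atTop (𝓝 l) := by
    intro d
    by_cases hd : d ∣ q
    · obtain ⟨l, hl⟩ := PolarErasure.exists_tendsto_muAvg hε
        (Nat.mem_divisors.mpr ⟨hd, NeZero.ne q⟩)
      exact ⟨l, fun _ => hl⟩
    · exact ⟨0, fun h => absurd h hd⟩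
  choose μ hμ using hex
  have hN : ∀ (γ : (ZMod q)ˣ) (δ : ℝ), 0 < δ → δ < Real.logb q q.minFac →
      ∀ N : AddSubgroup (ZMod q), Tendsto
        (PolarErasure.levelFraction γ (PolarErasure.erasureChannel q ε hε)
          N (Real.logb q N.index) δ) atTop (𝓝 (μ N.index)) :=
    fun γ δ hδ hδ' N => PolarErasure.tendsto_levelFraction hq hε γ hδ hδ' N
      (hμ N.index (by simpa using N.index_dvd_card))
  refine ⟨μ, hμ, fun γ δ hδ hδ' => ⟨fun d hd => ?_, hN γ δ hδ hδ'⟩, ?_⟩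
  · have h := hN γ δ hδ hδ' (PolarErasure.phi hd).toAddMonoidHom.ker
    rwa [PolarErasure.index_ker_phi hd] at h
  -- The finite sum of averages equals 1 for every `n`, hence so does the sum of their limits.
  · refine tendsto_nhds_unique (tendsto_finsetSum q.divisors fun d hd =>
      hμ d (Nat.dvd_of_mem_divisors hd)) ?_
    simp only [PolarErasure.sum_muAvg hε]
    exact tendsto_const_nhds
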